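/- **Conventions.** Let $(M,g)$ be a smooth Riemannian $3$-manifold with Levi-Civita connection $\nabla$, curvature $R(X,Y)Z=\nabla_X\nabla_YZ-\nabla_Y\nabla_XZ-\nabla_{[X,Y]}Z$, Ricci tensor $S(Y,Z)=\operatorname{tr}(X\mapsto R(X,Y)Z)$ and scalar curvature $r$. An almost contact metric structure on $(M,g)$ consists of a smooth $(1,1)$-tensor field $\phi$, a smooth vector field $\xi$ and a smooth $1$-form $\eta$ such that, for all vector fields $X,Y$, $$\phi^2=-I+\eta\otimes\xi,\quad \eta(\xi)=1,\quad \eta(X)=g(X,\xi),\quad g(\phi X,\phi Y)=g(X,Y)-\eta(X)\eta(Y),\quad g(X,\phi Y)+g(Y,\phi X)=0.$$ For smooth functions $\alpha,\beta:M\to\mathbb R$ it is trans-Sasakian of type $(\alpha,\beta)$ if $$(\nabla_X\phi)Y=\alpha\,[g(X,Y)\xi-\eta(Y)X]+\beta\,[g(\phi X,Y)\xi-\eta(Y)\phi X]\quad\text{for all }X,Y,$$ and $\beta$-Kenmotsu if it is trans-Sasakian of type $(0,\beta)$. For real constants $\lambda,\mu$, the data $(g,\xi,\lambda,\mu)$ is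 an $\eta$-Einstein soliton if $$\mathcal L_\xi g+2S+(2\lambda-r)g+2\mu\,\eta\otimes\eta=0;$$ it is called shrinking, steady or expanding if $\lambda<0$, $\lambda=0$ or $\lambda>0$ respectively. The Ricci tensor is of Codazzi type if $S$ is not identically zero and $(\nabla_XS)(Y,Z)=(\nabla_YS)(X,Z)$ for all $X,Y,Z$. **Theorem.** Let $(M,g,\phi,\xi,\eta)$ be a trans-Sasakian $3$-manifold of type $(\alpha,\beta)$, where $\alpha,\beta$ are smooth functions, which admits an $\eta$-Einstein soliton $(g,\xi,\lambda,\mu)$ and whose Ricci tensor is of Codazzi type. 1. At every point $p\in M$ with $\mu\ne\beta(p)$ one has $\alpha(p)=0$ and $\lambda=-\beta(p)(\beta(p)+1)$. 2. If $\mu\neq\beta(p)$ for every $p\in M$, or if $M$ is connected and $\beta$ is not identically equal to $\mu$, then $\alpha=0$ on $M$, so that the manifold is $\beta$-Kenmotsu, and $\lambda=-\beta(\beta+1)$ at every point. Consequently the soliton is shrinking if $\beta<-1$ or $\beta>0$ at some point, steady if $\beta=-1$ or $\beta=0$ at some point, and expanding if $-1<\beta<0$ at some point. -/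

import Mathlib

open Bundle VectorField
open scoped Manifold ContDiff

noncomputable section

namespace TransSasakian

section Riemannian

set_option linter.unusedSectionVars false
set_option linter.unusedSimpArgs false

variable {E : Type*} [NormedAddCommGroup E] [NormedSpace ℝ E] [FiniteDimensional ℝ E]
  {M : Type*} [TopologicalSpace M] [ChartedSpace E M] [IsManifold 𝓘(ℝ, E) ∞ M]
  (g : ContMDiffRiemannianMetric 𝓘(ℝ, E) ∞ E (fun x : M => TangentSpace 𝓘(ℝ, E) x))

/-- The function `g(X, Y)`, for vector fields `X`, `Y`. -/
def metric (X Y : Π x : M, TangentSpace 𝓘(ℝ, E) x) (x : M) : ℝ := g.inner x (X x) (Y x)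

/-- The right-hand side of the Koszul formula at the point `x`:
`X g(Y,Z) + Y g(Z,X) - Z g(X,Y) - g(X,[Y,Z]) + g(Y,[Z,X]) + g(Z,[X,Y])`. -/
def koszul (X Y Z : Π x : M, TangentSpace 𝓘(ℝ, E) x) (x : M) : ℝ :=
  mvfderiv 𝓘(ℝ, E) (metric g Y Z) x (X x) + mvfderiv 𝓘(ℝ, E) (metric g Z X) x (Y x)
    - mvfderiv 𝓘(ℝ, E) (metric g X Y) x (Z x)
    - g.inner x (X x) (mlieBracket 𝓘(ℝ, E) Y Z x)
    + g.inner x (Y x) (mlieBracket 𝓘(ℝ, E) Z X x)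
    + g.inner x (Z x) (mlieBracket 𝓘(ℝ, E) X Y x)

variable {X X' Y Y' Z : Π x : M, TangentSpace 𝓘(ℝ, E) x} {x : M}

lemma mdifferentiableAt_metric (hX : MDiffAt (T% X) x) (hY : MDiffAt (T% Y) x) :
    MDiffAt (metric g X Y) x := by
  let : RiemannianBundle (fun x : M => TangentSpace 𝓘(ℝ, E) x) := ⟨g.toRiemannianMetric⟩
  exact MDifferentiableAt.inner_bundle (E := fun x : M => TangentSpace 𝓘(ℝ, E) x) (b := id) hX hY

lemma metric_comm : metric g X Y = metric g Y X := funext fun x => g.symm x _ _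

lemma metric_smul_left (f : M → ℝ) : metric g (f • X) Y = f * metric g X Y := by
  funext x; simp [metric]

lemma metric_smul_right (f : M → ℝ) : metric g X (f • Y) = f * metric g X Y := by
  funext x; simp [metric]

lemma metric_add_left : metric g (X + X') Y = metric g X Y + metric g X' Y := by
  funext x; simp [metric]

lemma metric_add_right : metric g X (Y + Y') = metric g X Y + metric g X Y' := by
  funext x; simp [metric]

lemma koszul_tensorial_left (hY : MDiffAt (T% Y) x) (hZ : MDiffAt (T% Z) x) :
    TensorialAt 𝓘(ℝ, E) E (fun X => koszul g X Y Z x) x where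
  smul {f X} hf hX := by
    have h1 := mdifferentiableAt_metric g hX hY
    have h2 := mdifferentiableAt_metric g hZ hX
    simp only [koszul, metric_smul_left, metric_smul_right, mvfderiv_mul hf h1,
      mvfderiv_mul hf h2, mlieBracket_smul_left hf hX, mlieBracket_smul_right hf hX]
    have e1 := g.symm x (X x) (Y x)
    have e2 := g.symm x (X x) (Z x)
    simp [metric]
    simp only [e1, e2]
    ring
  add {X X'} hX hX' := by
    simp only [koszul, metric_add_left, metric_add_right,
      mvfderiv_add (mdifferentiableAt_metric g hX hY) (mdifferentiableAt_metric g hX' hY),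
      mvfderiv_add (mdifferentiableAt_metric g hZ hX) (mdifferentiableAt_metric g hZ hX'),
      mlieBracket_add_left hX hX', mlieBracket_add_right hX hX']
    simp
    ring

lemma koszul_tensorial_right (hX : MDiffAt (T% X) x) (hY : MDiffAt (T% Y) x) :
    TensorialAt 𝓘(ℝ, E) E (fun Z => koszul g X Y Z x) x where
  smul {f Z} hf hZ := by
    have h1 := mdifferentiableAt_metric g hY hZ
    have h2 := mdifferentiableAt_metric g hZ hX
    simp only [koszul, metric_smul_left, metric_smul_right, mvfderiv_mul hf h1,
      mvfderiv_mul hf h2, mlieBracket_smul_left hf hZ, mlieBracket_smul_right hf hZ]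
    have e1 := g.symm x (Z x) (Y x)
    have e2 := g.symm x (Z x) (X x)
    simp [metric]
    simp only [e1, e2]
    ring
  add {Z Z'} hZ hZ' := by
    simp only [koszul, metric_add_left, metric_add_right,
      mvfderiv_add (mdifferentiableAt_metric g hY hZ) (mdifferentiableAt_metric g hY hZ'),
      mvfderiv_add (mdifferentiableAt_metric g hZ hX) (mdifferentiableAt_metric g hZ' hX),
      mlieBracket_add_left hZ hZ', mlieBracket_add_right hZ hZ']
    simp
    ring

lemma koszul_add_mid (hX : MDiffAt (T% X) x) (hZ : MDiffAt (T% Z) x)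
    (hY : MDiffAt (T% Y) x) (hY' : MDiffAt (T% Y') x) :
    koszul g X (Y + Y') Z x = koszul g X Y Z x + koszul g X Y' Z x := by
  simp only [koszul, metric_add_left, metric_add_right,
    mvfderiv_add (mdifferentiableAt_metric g hY hZ) (mdifferentiableAt_metric g hY' hZ),
    mvfderiv_add (mdifferentiableAt_metric g hX hY) (mdifferentiableAt_metric g hX hY'),
    mlieBracket_add_left hY hY', mlieBracket_add_right hY hY']
  simp
  ring

lemma koszul_smul_mid {f : M → ℝ} (hf : MDiffAt f x) (hX : MDiffAt (T% X) x)
    (hY : MDiffAt (T% Y) x) (hZ : MDiffAt (T% Z) x) :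
    koszul g X (f • Y) Z x =
      f x * koszul g X Y Z x + 2 * (mvfderiv 𝓘(ℝ, E) f x (X x) * g.inner x (Y x) (Z x)) := by
  simp only [koszul, metric_smul_left, metric_smul_right,
    mvfderiv_mul hf (mdifferentiableAt_metric g hY hZ),
    mvfderiv_mul hf (mdifferentiableAt_metric g hX hY),
    mlieBracket_smul_left hf hY, mlieBracket_smul_right hf hY]
  have e1 := g.symm x (Z x) (Y x)
  simp [metric]
  rw [e1]
  ring

/-- `z ↦ g(v, z)`, as a linear isomorphism from the tangent space onto its dual. -/
def flat (x : M) : TangentSpace 𝓘(ℝ, E) x ≃ₗ[ℝ] Module.Dual ℝ (TangentSpace 𝓘(ℝ, E) x) :=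
  haveI : FiniteDimensional ℝ (TangentSpace 𝓘(ℝ, E) x) := inferInstanceAs (FiniteDimensional ℝ E)
  LinearMap.linearEquivOfInjective
    { toFun v := (g.inner x v).toLinearMap
      map_add' v w := by ext; simp
      map_smul' c v := by ext; simp }
    (by
      intro v w h
      by_contra hne
      have := g.pos x (v - w) (sub_ne_zero.2 hne)
      have h2 := LinearMap.congr_fun h (v - w)
      simp at h2 this
      linarith)
    Subspace.dual_finrank_eq.symm

lemma flat_apply (v w : TangentSpace 𝓘(ℝ, E) x) : flat g x v w = g.inner x v w := rfl

/-- The bilinear map `(X x, Z x) ↦ koszul X Y Z x`, for a vector field `Y` differentiable at `x`. -/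
def koszulForm (Y : Π x : M, TangentSpace 𝓘(ℝ, E) x) (x : M) (hY : MDiffAt (T% Y) x) :
    TangentSpace 𝓘(ℝ, E) x →L[ℝ] TangentSpace 𝓘(ℝ, E) x →L[ℝ] ℝ :=
  TensorialAt.mkHom₂ (I := 𝓘(ℝ, E)) (F := E) (F' := E) (fun X Z => koszul g X Y Z x) x
    (fun _ hZ => koszul_tensorial_left g hY hZ) (fun _ hX => koszul_tensorial_right g hX hY)

open scoped Classical in
/-- The Levi-Civita derivative, defined by the Koszul formula
`2 g(∇_v Y, z) = koszul V Y Z` with `V`, `Z` any extensions of `v`, `z`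
(and by the junk value `0` at points where `Y` is not differentiable). -/
def leviCivitaFun (Y : Π x : M, TangentSpace 𝓘(ℝ, E) x) (x : M) :
    TangentSpace 𝓘(ℝ, E) x →L[ℝ] TangentSpace 𝓘(ℝ, E) x :=
  haveI : FiniteDimensional ℝ (TangentSpace 𝓘(ℝ, E) x) := inferInstanceAs (FiniteDimensional ℝ E)
  haveI : T2Space (TangentSpace 𝓘(ℝ, E) x) := inferInstanceAs (T2Space E)
  if hY : MDiffAt (T% Y) x then
    LinearMap.toContinuousLinearMap
      { toFun v := (2⁻¹ : ℝ) • (flat g x).symm (koszulForm g Y x hY v).toLinearMap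
        map_add' v w := by
          rw [← smul_add, ← map_add]
          congr 2
          ext; simp
        map_smul' c v := by
          rw [RingHom.id_apply, smul_comm, ← map_smul (flat g x).symm c]
          congr 2
          ext; simp }
  else 0

lemma two_mul_inner_leviCivitaFun (hX : MDiffAt (T% X) x) (hY : MDiffAt (T% Y) x)
    (hZ : MDiffAt (T% Z) x) :
    2 * g.inner x (leviCivitaFun g Y x (X x)) (Z x) = koszul g X Y Z x := by
  have h : koszulForm g Y x hY (X x) (Z x) = koszul g X Y Z x :=
    TensorialAt.mkHom₂_apply _ _ hX hZ
  rw [← h, ← flat_apply, leviCivitaFun, dif_pos hY]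
  simp

lemma inner_left_injective {v w : TangentSpace 𝓘(ℝ, E) x}
    (h : ∀ Z : Π x : M, TangentSpace 𝓘(ℝ, E) x, MDiffAt (T% Z) x →
      2 * g.inner x v (Z x) = 2 * g.inner x w (Z x)) : v = w := by
  apply (flat g x).injective
  ext z
  have := h (FiberBundle.extend E z) (FiberBundle.mdifferentiableAt_extend ..)
  rw [FiberBundle.extend_apply_self] at this
  rw [flat_apply, flat_apply]
  linarith

/-- The Levi-Civita connection of `g`: `leviCivita g Y x v` is `∇_v Y`. -/
def leviCivita : CovariantDerivative 𝓘(ℝ, E) E (fun x : M => TangentSpace 𝓘(ℝ, E) x) where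
  toFun := leviCivitaFun g
  isCovariantDerivativeOnUniv :=
    { add {Y Y' x} hY hY' _ := by
        ext v
        apply inner_left_injective g
        intro Z hZ
        have hX := FiberBundle.mdifferentiableAt_extend 𝓘(ℝ, E) E v
        have h := koszul_add_mid g hX hZ hY hY'
        rw [← two_mul_inner_leviCivitaFun g hX hY hZ, ← two_mul_inner_leviCivitaFun g hX hY' hZ,
          ← two_mul_inner_leviCivitaFun g hX (mdifferentiableAt_add_section hY hY') hZ,
          FiberBundle.extend_apply_self] at h
        simp only [h, add_apply, map_add]
        ring
      leibniz {Y f x} hY hf _ := by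
        ext v
        apply inner_left_injective g
        intro Z hZ
        have hX := FiberBundle.mdifferentiableAt_extend 𝓘(ℝ, E) E v
        have h := koszul_smul_mid g hf hX hY hZ
        rw [← two_mul_inner_leviCivitaFun g hX hY hZ,
          ← two_mul_inner_leviCivitaFun g hX (hf.smul_section hY) hZ,
          FiberBundle.extend_apply_self] at h
        simp [h]
        ring }

/-- The Koszul formula. -/
theorem two_mul_inner_leviCivita (hX : MDiffAt (T% X) x) (hY : MDiffAt (T% Y) x)
    (hZ : MDiffAt (T% Z) x) :
    2 * g.inner x (leviCivita g Y x (X x)) (Z x) = koszul g X Y Z x :=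
  two_mul_inner_leviCivitaFun g hX hY hZ

/-- The Levi-Civita connection is torsion-free. -/
theorem leviCivita_torsionFree (hX : MDiffAt (T% X) x) (hY : MDiffAt (T% Y) x) :
    leviCivita g Y x (X x) - leviCivita g X x (Y x) = mlieBracket 𝓘(ℝ, E) X Y x := by
  apply inner_left_injective g
  intro Z hZ
  have h1 := two_mul_inner_leviCivita g hX hY hZ
  have h2 := two_mul_inner_leviCivita g hY hX hZ
  have e := g.symm x (mlieBracket 𝓘(ℝ, E) X Y x) (Z x)
  rw [map_sub, sub_apply, mul_sub, h1, h2, e]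
  simp only [koszul]
  rw [metric_comm g (X := X) (Y := Z), metric_comm g (X := Z) (Y := Y),
    metric_comm g (X := Y) (Y := X), mlieBracket_swap_apply (V := Y) (W := X),
    mlieBracket_swap_apply (V := X) (W := Z), mlieBracket_swap_apply (V := Z) (W := Y)]
  simp only [map_neg]
  ring

/-- The Levi-Civita connection is compatible with the metric. -/
theorem leviCivita_metric (hX : MDiffAt (T% X) x) (hY : MDiffAt (T% Y) x)
    (hZ : MDiffAt (T% Z) x) :
    mvfderiv 𝓘(ℝ, E) (metric g Y Z) x (X x) =
      g.inner x (leviCivita g Y x (X x)) (Z x) + g.inner x (Y x) (leviCivita g Z x (X x)) := by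
  have h1 := two_mul_inner_leviCivita g hX hY hZ
  have h2 := two_mul_inner_leviCivita g hX hZ hY
  have e := g.symm x (Y x) (leviCivita g Z x (X x))
  simp only [koszul] at h1 h2
  rw [metric_comm g (X := Z) (Y := Y), metric_comm g (X := Y) (Y := X),
    metric_comm g (X := X) (Y := Z), mlieBracket_swap_apply (V := Z) (W := Y),
    mlieBracket_swap_apply (V := Y) (W := X), mlieBracket_swap_apply (V := X) (W := Z)] at h2
  simp only [map_neg] at h2
  rw [e]
  linarith

/-- The curvature operator `R(X,Y)Z = ∇_X ∇_Y Z - ∇_Y ∇_X Z - ∇_{[X,Y]} Z` at `x`. -/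
def curvature (X Y Z : Π x : M, TangentSpace 𝓘(ℝ, E) x) (x : M) : TangentSpace 𝓘(ℝ, E) x :=
  leviCivita g (fun y => leviCivita g Z y (Y y)) x (X x)
    - leviCivita g (fun y => leviCivita g Z y (X y)) x (Y x)
    - leviCivita g Z x (mlieBracket 𝓘(ℝ, E) X Y x)

/-- Some basis of the tangent space at `x` (only used for traces, which do not depend on it). -/
def tangentBasis (x : M) :
    Module.Basis (Fin (Module.finrank ℝ E)) ℝ (TangentSpace 𝓘(ℝ, E) x) :=
  Module.finBasis ℝ E

/-- The Ricci tensor `S(v,w)`, the trace of the endomorphism `u ↦ R(u,v)w` of the tangent space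
at `x`. The vectors are extended to vector fields near `x` in order to apply `R`, which is
tensorial. -/
def ricci (x : M) (v w : TangentSpace 𝓘(ℝ, E) x) : ℝ :=
  ∑ i, (tangentBasis x).coord i
    (curvature g (FiberBundle.extend E (tangentBasis x i)) (FiberBundle.extend E v)
      (FiberBundle.extend E w) x)

/-- The Gram matrix `g_ij` of the metric at `x`. -/
def gram (x : M) : Matrix (Fin (Module.finrank ℝ E)) (Fin (Module.finrank ℝ E)) ℝ :=
  Matrix.of fun i j => g.inner x (tangentBasis x i) (tangentBasis x j)

/-- The scalar curvature `r = g^ij S_ij`. -/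
def scalarCurvature (x : M) : ℝ :=
  ∑ i, ∑ j, (gram g x)⁻¹ i j * ricci g x (tangentBasis x i) (tangentBasis x j)

/-- The covariant derivative of the Ricci tensor:
`(∇_X S)(Y,Z) = X(S(Y,Z)) - S(∇_X Y,Z) - S(Y,∇_X Z)` at `x`. -/
def nablaRicci (X Y Z : Π x : M, TangentSpace 𝓘(ℝ, E) x) (x : M) : ℝ :=
  mvfderiv 𝓘(ℝ, E) (fun y => ricci g y (Y y) (Z y)) x (X x)
    - ricci g x (leviCivita g Y x (X x)) (Z x) - ricci g x (Y x) (leviCivita g Z x (X x))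

/-- The Lie derivative of the metric: `(L_V g)(X,Y) = V(g(X,Y)) - g([V,X],Y) - g(X,[V,Y])`. -/
def lieDerivMetric (V X Y : Π x : M, TangentSpace 𝓘(ℝ, E) x) (x : M) : ℝ :=
  mvfderiv 𝓘(ℝ, E) (metric g X Y) x (V x)
    - g.inner x (mlieBracket 𝓘(ℝ, E) V X x) (Y x) - g.inner x (X x) (mlieBracket 𝓘(ℝ, E) V Y x)

/-- The vector field `X` is smooth at `x`. Identities between tensors are required below for all
vector fields smooth at the point considered; by tensoriality this is the same as requiring them
for all global smooth vector fields. -/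
def SmoothFieldAt (X : Π x : M, TangentSpace 𝓘(ℝ, E) x) (x : M) : Prop :=
  ContMDiffAt 𝓘(ℝ, E) (𝓘(ℝ, E).prod 𝓘(ℝ, E)) ∞ (fun y => TotalSpace.mk' E y (X y)) x

/-- Codazzi type Ricci tensor: `S` is not identically zero and
`(∇_X S)(Y,Z) = (∇_Y S)(X,Z)` for all `X`, `Y`, `Z`. -/
def HasCodazziRicci : Prop :=
  (∃ (x : M) (v w : TangentSpace 𝓘(ℝ, E) x), ricci g x v w ≠ 0) ∧
  ∀ (x : M) (X Y Z : Π x : M, TangentSpace 𝓘(ℝ, E) x),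
    SmoothFieldAt X x → SmoothFieldAt Y x → SmoothFieldAt Z x →
      nablaRicci g X Y Z x = nablaRicci g Y X Z x

/-- An almost contact metric structure `(φ, ξ, η)` on the Riemannian manifold `(M, g)`. -/
structure AlmostContactMetric where
  /-- the (1,1)-tensor field `φ` -/
  phi : Π x : M, TangentSpace 𝓘(ℝ, E) x →L[ℝ] TangentSpace 𝓘(ℝ, E) x
  /-- the characteristic vector field `ξ` -/
  xi : Π x : M, TangentSpace 𝓘(ℝ, E) x
  /-- the 1-form `η` -/
  eta : Π x : M, TangentSpace 𝓘(ℝ, E) x →L[ℝ] ℝ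
  smooth_phi : ContMDiff 𝓘(ℝ, E) (𝓘(ℝ, E).prod 𝓘(ℝ, E →L[ℝ] E)) ∞
    (fun x => (TotalSpace.mk' (E →L[ℝ] E) x (phi x) :
      TotalSpace (E →L[ℝ] E)
        (fun x : M => TangentSpace 𝓘(ℝ, E) x →L[ℝ] TangentSpace 𝓘(ℝ, E) x)))
  smooth_xi : ∀ x, SmoothFieldAt xi x
  smooth_eta : ContMDiff 𝓘(ℝ, E) (𝓘(ℝ, E).prod 𝓘(ℝ, E →L[ℝ] ℝ)) ∞
    (fun x => (TotalSpace.mk' (E →L[ℝ] ℝ) x (eta x) :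
      TotalSpace (E →L[ℝ] ℝ) (fun x : M => TangentSpace 𝓘(ℝ, E) x →L[ℝ] ℝ)))
  phi_phi : ∀ (x : M) (v : TangentSpace 𝓘(ℝ, E) x), phi x (phi x v) = -v + eta x v • xi x
  eta_xi : ∀ x : M, eta x (xi x) = 1
  eta_eq : ∀ (x : M) (v : TangentSpace 𝓘(ℝ, E) x), eta x v = g.inner x v (xi x)
  metric_phi_phi : ∀ (x : M) (v w : TangentSpace 𝓘(ℝ, E) x),
    g.inner x (phi x v) (phi x w) = g.inner x v w - eta x v * eta x w
  metric_phi : ∀ (x : M) (v w : TangentSpace 𝓘(ℝ, E) x),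
    g.inner x v (phi x w) + g.inner x w (phi x v) = 0

namespace AlmostContactMetric

variable {g} (A : AlmostContactMetric g)

/-- `(∇_X φ)(Y) = ∇_X (φ Y) - φ (∇_X Y)` at `x`. -/
def nablaPhi (X Y : Π x : M, TangentSpace 𝓘(ℝ, E) x) (x : M) : TangentSpace 𝓘(ℝ, E) x :=
  leviCivita g (fun y => A.phi y (Y y)) x (X x) - A.phi x (leviCivita g Y x (X x))

/-- The structure is trans-Sasakian of type `(α, β)`, for smooth functions `α` and `β`:
`(∇_X φ)Y = α (g(X,Y)ξ - η(Y)X) + β (g(φX,Y)ξ - η(Y)φX)`. -/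
structure IsTransSasakian (α β : M → ℝ) : Prop where
  smooth_alpha : ContMDiff 𝓘(ℝ, E) 𝓘(ℝ, ℝ) ∞ α
  smooth_beta : ContMDiff 𝓘(ℝ, E) 𝓘(ℝ, ℝ) ∞ β
  nablaPhi_eq : ∀ (x : M) (X Y : Π x : M, TangentSpace 𝓘(ℝ, E) x),
    SmoothFieldAt X x → SmoothFieldAt Y x →
      A.nablaPhi X Y x =
        α x • (g.inner x (X x) (Y x) • A.xi x - A.eta x (Y x) • X x)
        + β x • (g.inner x (A.phi x (X x)) (Y x) • A.xi x - A.eta x (Y x) • A.phi x (X x))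

/-- A `β`-Kenmotsu structure is a trans-Sasakian structure of type `(0, β)`. -/
def IsBetaKenmotsu (β : M → ℝ) : Prop := A.IsTransSasakian (fun _ => 0) β

/-- `(g, ξ, lam, mu)` is an `η`-Einstein soliton:
`L_ξ g + 2 S + (2 lam - r) g + 2 mu η ⊗ η = 0`. -/
def IsEtaEinsteinSoliton (lam mu : ℝ) : Prop :=
  ∀ (x : M) (X Y : Π x : M, TangentSpace 𝓘(ℝ, E) x),
    SmoothFieldAt X x → SmoothFieldAt Y x →
      lieDerivMetric g A.xi X Y x + 2 * ricci g x (X x) (Y x)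
        + (2 * lam - scalarCurvature g x) * g.inner x (X x) (Y x)
        + 2 * mu * (A.eta x (X x) * A.eta x (Y x)) = 0

end AlmostContactMetric

end Riemannian
end TransSasakian

end

open scoped Topology

namespace TransSasakian

set_option linter.unusedSectionVars false

variable {E : Type*} [NormedAddCommGroup E] [NormedSpace ℝ E] [FiniteDimensional ℝ E]
  {M : Type*} [TopologicalSpace M] [ChartedSpace E M] [IsManifold 𝓘(ℝ, E) ∞ M]
  (g : ContMDiffRiemannianMetric 𝓘(ℝ, E) ∞ E (fun x : M => TangentSpace 𝓘(ℝ, E) x))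

variable {X Y Z W : Π x : M, TangentSpace 𝓘(ℝ, E) x} {x : M}

/-! Since `∇_v ξ = -α φv + β (v - η(v)ξ)`, the soliton equation and its trace in dimension 3 force
`S = (2λ+β+μ) g + (β-μ) η⊗η` (`ricci_eq`). Where `β ≠ μ`, testing the Codazzi equation on `v ⊥ ξ`,
`φv` and `ξ` gives `α = 0` and `ξβ = β(β-μ)` (`alpha_eq_zero_and_mvfderiv_beta`).

As `{β ≠ μ}` is open, `α` vanishes on a neighbourhood, and a direct curvature computation gives
`S(ξ,ξ) = -2(ξβ + β²)` (`ricci_xi_xi`). Comparison with `S(ξ,ξ) = 2λ + 2β` yields `λ = -2β² +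
(μ-1)β`. Differentiating along `ξ` shows that `β` is locally constant where `β(β-μ) ≠ 0`, which
contradicts `ξβ = β(β-μ) ≠ 0`. Hence `β = 0` and `λ = 0` wherever `β ≠ μ`, which is stronger than `λ
= -β(β+1)`.

The preliminary lemmas supply the regularity needed to differentiate `∇_X Y`, and the fact that
`R(X,Y)Z` is pointwise in `Z`. -/

/-! ### Regularity of smooth fields and of functions built from them. -/

lemma SmoothFieldAt.contMDiffAt (h : SmoothFieldAt X x) (n : ℕ∞) :
    CMDiffAt n (T% X) x :=
  ContMDiffAt.of_le h (by exact_mod_cast le_top)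

lemma SmoothFieldAt.mdifferentiableAt (h : SmoothFieldAt X x) : MDiffAt (T% X) x :=
  (h.contMDiffAt 1).mdifferentiableAt (by simp)

lemma SmoothFieldAt.eventually_mdifferentiableAt (h : SmoothFieldAt X x) :
    ∀ᶠ y in 𝓝 x, MDiffAt (T% X) y := by
  have := (contMDiffAt_iff_contMDiffAt_nhds (n := 1) (by simp)).1 (h.contMDiffAt 1)
  exact this.mono fun y hy => hy.mdifferentiableAt (by simp)

lemma smoothFieldAt_extend (v : TangentSpace 𝓘(ℝ, E) x) :
    SmoothFieldAt (FiberBundle.extend E v) x :=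
  FiberBundle.contMDiffAt_extend 𝓘(ℝ, E) E v

lemma contMDiffAt_metric {n : ℕ∞} (hX : CMDiffAt n (T% X) x) (hY : CMDiffAt n (T% Y) x) :
    CMDiffAt n (metric g X Y) x := by
  let : RiemannianBundle (fun x : M => TangentSpace 𝓘(ℝ, E) x) := ⟨g.toRiemannianMetric⟩
  have : IsContMDiffRiemannianBundle 𝓘(ℝ, E) n E (fun x : M => TangentSpace 𝓘(ℝ, E) x) :=
    IsContMDiffRiemannianBundle.of_le (n := ∞) (by exact_mod_cast le_top)
  exact ContMDiffAt.inner_bundle (E := fun x : M => TangentSpace 𝓘(ℝ, E) x) (b := id) hX hY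

lemma mdifferentiableAt_mvfderiv_apply {f : M → ℝ} (hf : CMDiffAt 2 f x)
    (hX : MDiffAt (T% X) x) : MDiffAt (fun y => mvfderiv 𝓘(ℝ, E) f y (X y)) x := by
  have h1 := (hf.mfderiv_const (m := 1) (by norm_num)).mdifferentiableAt (by simp)
  have h2 := MDifferentiableAt.clm_apply_of_inCoordinates (F₁ := E) (F₂ := ℝ)
    (E₁ := TangentSpace 𝓘(ℝ, E)) (E₂ := TangentSpace 𝓘(ℝ, ℝ)) (b₁ := id) (b₂ := f)
    (ϕ := fun y => mfderiv 𝓘(ℝ, E) 𝓘(ℝ, ℝ) f y) (v := X) h1 hX (hf.mdifferentiableAt (by simp))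
  rw [mdifferentiableAt_totalSpace] at h2
  simp at h2
  exact h2.2

lemma mvfderiv_congr {f f' : M → ℝ} (h : f =ᶠ[𝓝 x] f') :
    mvfderiv 𝓘(ℝ, E) f x = mvfderiv 𝓘(ℝ, E) f' x := by
  ext v
  simp only [mvfderiv, ContinuousLinearMap.comp_apply, h.mfderiv_eq]
  rfl

/-! ### Lie brackets acting on functions. -/

lemma mdifferentiableAt_mlieBracket (hX : CMDiffAt 2 (T% X) x) (hY : CMDiffAt 2 (T% Y) x) :
    MDiffAt (T% (mlieBracket 𝓘(ℝ, E) X Y)) x := by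
  have : IsManifold 𝓘(ℝ, E) ((2 : ℕ∞) + 1) M := IsManifold.of_le (n := ∞) (by exact_mod_cast le_top)
  have : IsManifold 𝓘(ℝ, E) (minSmoothness ℝ 2) M := by simpa using! (inferInstance : IsManifold 𝓘(ℝ, E) 2 M)
  exact (ContMDiffAt.mlieBracket_vectorField (m := 1) (n := 2) hX hY
    (by simp; norm_num)).mdifferentiableAt (by simp)

/-- `[X, Y] f = X (Y f) - Y (X f)`. -/
lemma mvfderiv_mlieBracket {f : M → ℝ} (hf : CMDiffAt 2 f x) (hX : SmoothFieldAt X x)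
    (hY : SmoothFieldAt Y x) :
    mvfderiv 𝓘(ℝ, E) f x (mlieBracket 𝓘(ℝ, E) X Y x) =
      mvfderiv 𝓘(ℝ, E) (fun y => mvfderiv 𝓘(ℝ, E) f y (Y y)) x (X x) -
      mvfderiv 𝓘(ℝ, E) (fun y => mvfderiv 𝓘(ℝ, E) f y (X y)) x (Y x) := by
  -- The argument compares coefficients of a nonzero vector, so the zero-dimensional case is
  -- separate.
  rcases subsingleton_or_nontrivial E with hE | hE
  · have (v : TangentSpace 𝓘(ℝ, E) x) : v = 0 := Subsingleton.elim (α := E) v 0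
    simp [this (mlieBracket 𝓘(ℝ, E) X Y x), this (X x), this (Y x)]
  obtain ⟨w, hw⟩ : ∃ w : TangentSpace 𝓘(ℝ, E) x, w ≠ 0 := exists_ne (0 : E)
  have hWs := smoothFieldAt_extend w
  set W := FiberBundle.extend E w with hWdef
  have hWx : W x = w := FiberBundle.extend_apply_self E w
  have : IsManifold 𝓘(ℝ, E) (minSmoothness ℝ 2) M := by simpa using! (inferInstance : IsManifold 𝓘(ℝ, E) 2 M)
  have : IsManifold 𝓘(ℝ, E) (minSmoothness ℝ 3) M := by simpa using! (inferInstance : IsManifold 𝓘(ℝ, E) 3 M)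
  have h2 {U : Π x : M, TangentSpace 𝓘(ℝ, E) x} (hU : SmoothFieldAt U x) : CMDiffAt 2 (T% U) x := hU.contMDiffAt 2
  have h2' {U : Π x : M, TangentSpace 𝓘(ℝ, E) x} (hU : CMDiffAt 2 (T% U) x) :
      CMDiffAt (minSmoothness ℝ 2) (T% U) x := by simpa using! hU
  have hfd : MDiffAt f x := hf.mdifferentiableAt (by simp)
  have hfW : CMDiffAt 2 (T% (f • W)) x := hf.smul_section (h2 hWs)
  -- Expand the Jacobi identity for `X`, `Y`, `f • W` by the Leibniz rule. Once `f` times the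
  -- identity for `X`, `Y`, `W` is removed and the mixed terms cancel, the coefficients of `W x ≠ 0`
  -- give the claim.
  have J1 := leibniz_identity_mlieBracket_apply (h2' (h2 hX)) (h2' (h2 hY)) (h2' hfW)
  have J2 := leibniz_identity_mlieBracket_apply (h2' (h2 hX)) (h2' (h2 hY)) (h2' (h2 hWs))
  have hfev : ∀ᶠ y in 𝓝 x, MDiffAt f y :=
    ((contMDiffAt_iff_contMDiffAt_nhds (n := 2) (by simp)).1 hf).mono
      fun y hy => hy.mdifferentiableAt (by simp)
  have key {U V : Π x : M, TangentSpace 𝓘(ℝ, E) x} (hU : SmoothFieldAt U x)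
      (hV : SmoothFieldAt V x) :
      mlieBracket 𝓘(ℝ, E) U (mlieBracket 𝓘(ℝ, E) V (f • W)) x =
        mvfderiv 𝓘(ℝ, E) (fun y => mvfderiv 𝓘(ℝ, E) f y (V y)) x (U x) • W x
        + mvfderiv 𝓘(ℝ, E) f x (V x) • mlieBracket 𝓘(ℝ, E) U W x
        + (mvfderiv 𝓘(ℝ, E) f x (U x) • mlieBracket 𝓘(ℝ, E) V W x
        + f x • mlieBracket 𝓘(ℝ, E) U (mlieBracket 𝓘(ℝ, E) V W) x) := by
    have e : mlieBracket 𝓘(ℝ, E) V (f • W) =ᶠ[𝓝 x]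
        ((fun y => mvfderiv 𝓘(ℝ, E) f y (V y)) • W) + f • mlieBracket 𝓘(ℝ, E) V W := by
      filter_upwards [hfev, hWs.eventually_mdifferentiableAt] with y h1 h2
      rw [mlieBracket_smul_right h1 h2]
      rfl
    have hd := mdifferentiableAt_mvfderiv_apply hf hV.mdifferentiableAt
    have hl := mdifferentiableAt_mlieBracket (h2 hV) (h2 hWs)
    rw [Filter.EventuallyEq.mlieBracket_vectorField_eq (Filter.EventuallyEq.refl (𝓝 x) U) e,
      mlieBracket_add_right (hd.smul_section hWs.mdifferentiableAt) (hfd.smul_section hl),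
      mlieBracket_smul_right hd hWs.mdifferentiableAt, mlieBracket_smul_right hfd hl]
  rw [key hX hY, key hY hX, mlieBracket_smul_right hfd hWs.mdifferentiableAt, J2, hWx] at J1
  refine smul_left_injective ℝ hw ?_
  simp only [sub_smul]
  rw [eq_sub_iff_add_eq]
  simp only [smul_add] at J1
  rw [← sub_eq_zero] at J1 ⊢
  rw [← neg_eq_zero, ← J1]
  abel

/-! ### Gram matrices, and differentiability tested by inner products. -/

lemma inner_left_ext {v w : TangentSpace 𝓘(ℝ, E) x}
    (h : ∀ z, g.inner x v z = g.inner x w z) : v = w :=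
  inner_left_injective g fun Z _ => by rw [h]

lemma mdifferentiableAt_det {ι : Type} [Fintype ι] [DecidableEq ι] {G : M → Matrix ι ι ℝ}
    (hG : ∀ i j, MDiffAt (fun y => G y i j) x) : MDiffAt (fun y => (G y).det) x := by
  have h1 (σ : Equiv.Perm ι) : MDiffAt (∏ i, fun y => G y (σ i) i) x :=
    MDifferentiableAt.prod fun i _ => hG (σ i) i
  have h2 (σ : Equiv.Perm ι) :
      MDiffAt ((fun _ : M => ((Equiv.Perm.sign σ : ℤ) : ℝ)) * ∏ i, fun y => G y (σ i) i) x :=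
    mdifferentiableAt_const.mul (h1 σ)
  have := MDifferentiableAt.sum (t := Finset.univ) fun σ _ => h2 σ
  refine this.congr_of_eventuallyEq (Filter.Eventually.of_forall fun y => ?_)
  simp [Matrix.det_apply']

/-- The Gram matrix of a basis of a tangent space is invertible. -/
lemma isUnit_det_gramMatrix {ι : Type*} [Fintype ι] [DecidableEq ι]
    (b : Module.Basis ι ℝ (TangentSpace 𝓘(ℝ, E) x)) :
    IsUnit (Matrix.of fun i j => g.inner x (b i) (b j)).det := by
  rw [← Matrix.isUnit_iff_isUnit_det, ← Matrix.vecMul_injective_iff_isUnit,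
    ← Matrix.coe_vecMulLinear, ← LinearMap.ker_eq_bot, LinearMap.ker_eq_bot']
  intro c hc
  let v := ∑ i, c i • b i
  have hv (w : TangentSpace 𝓘(ℝ, E) x) : g.inner x v w = 0 := by
    rw [← b.sum_repr w, map_sum]
    refine Finset.sum_eq_zero fun j _ => ?_
    have := congrFun hc j
    simp only [Matrix.vecMulLinear_apply, Matrix.vecMul, dotProduct, Matrix.of_apply,
      Pi.zero_apply] at this
    simp [v, this]
  have hv0 : v = 0 := by
    by_contra hne
    exact (g.pos x v hne).ne' (hv v)
  exact funext fun i => Fintype.linearIndependent_iff.1 b.linearIndependent c hv0 i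

/-- A vector field is differentiable as soon as its products with smooth vector fields are. -/
lemma mdifferentiableAt_of_metric
    (h : ∀ Z : Π x : M, TangentSpace 𝓘(ℝ, E) x, SmoothFieldAt Z x → MDiffAt (metric g X Z) x) :
    MDiffAt (T% X) x := by
  let e := trivializationAt E (fun x : M => TangentSpace 𝓘(ℝ, E) x) x
  let b := Module.finBasis ℝ E
  have hx : x ∈ e.baseSet := FiberBundle.mem_baseSet_trivializationAt' x
  have hs (i) : SmoothFieldAt (e.localFrame b i) x := contMDiffAt_localFrame_of_mem ∞ e b i hx
  let G (y : M) : Matrix (Fin (Module.finrank ℝ E)) (Fin (Module.finrank ℝ E)) ℝ :=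
    Matrix.of fun i j => metric g (e.localFrame b i) (e.localFrame b j) y
  have hG (i j) : MDiffAt (fun y => G y i j) x :=
    mdifferentiableAt_metric g (hs i).mdifferentiableAt (hs j).mdifferentiableAt
  have hdet (y) (hy : y ∈ e.baseSet) : IsUnit (G y).det :=by
    convert isUnit_det_gramMatrix g (e.basisAt b hy) using 3
    ext i j
    simp [metric, hy]
  rw [mdifferentiableAt_iff_localFrameCoeff (e := e) b hx]
  intro i
  -- Cramer's rule: the entries of the inverse are cofactors divided by a nonvanishing determinant.
  have hinv (j) : MDiffAt (fun y => (G y)⁻¹ j i) x := by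
    have h1 := (mdifferentiableAt_det hG).inv (hdet x hx).ne_zero
    have h2 : MDiffAt (fun y => (G y).adjugate j i) x := by
      simp only [Matrix.adjugate_apply]
      refine mdifferentiableAt_det fun k l => ?_
      simp only [Matrix.updateRow_apply]
      split_ifs
      · exact mdifferentiableAt_const
      · exact hG k l
    refine (h1.mul h2).congr_of_eventuallyEq (Filter.Eventually.of_forall fun y => ?_)
    simp [Matrix.inv_def]
  -- The frame components of `X` are recovered as `X^i = g(X, e_j) G^{ji}`.
  have hc : MDiffAt (fun y => ∑ j, metric g X (e.localFrame b j) y * (G y)⁻¹ j i) x := by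
    have := MDifferentiableAt.sum (t := Finset.univ)
      fun j _ => (h _ (hs j)).mul (hinv j)
    simpa [Finset.sum_fn] using this
  refine hc.congr_of_eventuallyEq ?_
  filter_upwards [e.open_baseSet.mem_nhds hx] with y hy
  have hXy := (e.basisAt b hy).sum_repr (X y)
  have : (fun j => metric g X (e.localFrame b j) y) =
      Matrix.vecMul (fun i => (e.basisAt b hy).repr (X y) i) (G y) := by
    funext j
    conv_lhs => rw [metric, ← hXy, map_sum, sum_apply]
    simp [Matrix.vecMul, dotProduct, G, metric, hy]
  simp [hy]
  change _ = Matrix.vecMul (fun j => metric g X (e.localFrame b j) y) (G y)⁻¹ i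
  rw [this, Matrix.vecMul_vecMul, Matrix.mul_nonsing_inv _ (hdet y hy), Matrix.vecMul_one]

/-! ### Second covariant derivatives and curvature. -/

lemma leviCivita_metric' (v : TangentSpace 𝓘(ℝ, E) x) (hY : MDiffAt (T% Y) x)
    (hZ : MDiffAt (T% Z) x) :
    mvfderiv 𝓘(ℝ, E) (metric g Y Z) x v =
      g.inner x (leviCivita g Y x v) (Z x) + g.inner x (Y x) (leviCivita g Z x v) := by
  have h := leviCivita_metric g (FiberBundle.mdifferentiableAt_extend 𝓘(ℝ, E) E v) hY hZ
  rwa [FiberBundle.extend_apply_self] at h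

/-- `∇_X Y` is differentiable when `X` and `Y` are smooth. -/
lemma mdifferentiableAt_leviCivita (hX : SmoothFieldAt X x) (hY : SmoothFieldAt Y x) :
    MDiffAt (T% (fun y => leviCivita g Y y (X y))) x := by
  apply mdifferentiableAt_of_metric g
  intro Z hZ
  have hb {U V} (hU : SmoothFieldAt U x) (hV : SmoothFieldAt V x) :
      CMDiffAt 2 (metric g U V) x := contMDiffAt_metric g (hU.contMDiffAt 2) (hV.contMDiffAt 2)
  have hl {U V} (hU : SmoothFieldAt U x) (hV : SmoothFieldAt V x) :
      MDiffAt (T% (mlieBracket 𝓘(ℝ, E) U V)) x :=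
    mdifferentiableAt_mlieBracket (hU.contMDiffAt 2) (hV.contMDiffAt 2)
  have hk : MDiffAt (koszul g X Y Z) x := by
    have h1 := mdifferentiableAt_mvfderiv_apply (hb hY hZ) hX.mdifferentiableAt
    have h2 := mdifferentiableAt_mvfderiv_apply (hb hZ hX) hY.mdifferentiableAt
    have h3 := mdifferentiableAt_mvfderiv_apply (hb hX hY) hZ.mdifferentiableAt
    have h4 := mdifferentiableAt_metric g hX.mdifferentiableAt (hl hY hZ)
    have h5 := mdifferentiableAt_metric g hY.mdifferentiableAt (hl hZ hX)
    have h6 := mdifferentiableAt_metric g hZ.mdifferentiableAt (hl hX hY)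
    exact ((((h1.add h2).sub h3).sub h4).add h5).add h6
  -- Near `x`, `g(∇_X Y, Z)` is half the Koszul expression, which involves only first derivatives of
  -- smooth data.
  have hk2 : MDiffAt ((fun _ : M => (2⁻¹ : ℝ)) * koszul g X Y Z) x :=
    mdifferentiableAt_const.mul hk
  refine hk2.congr_of_eventuallyEq ?_
  filter_upwards [hX.eventually_mdifferentiableAt, hY.eventually_mdifferentiableAt,
    hZ.eventually_mdifferentiableAt] with y h1 h2 h3
  have := two_mul_inner_leviCivita g h1 h2 h3
  simp only [metric, Pi.mul_apply, ← this]
  ring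

/-- The curvature operator is skew-symmetric. -/
lemma inner_curvature_comm (hX : SmoothFieldAt X x) (hY : SmoothFieldAt Y x)
    (hZ : SmoothFieldAt Z x) (hW : SmoothFieldAt W x) :
    g.inner x (curvature g X Y Z x) (W x) = - g.inner x (Z x) (curvature g X Y W x) := by
  have hf : CMDiffAt 2 (metric g Z W) x :=
    contMDiffAt_metric g (hZ.contMDiffAt 2) (hW.contMDiffAt 2)
  have hbr := mvfderiv_mlieBracket hf hX hY
  have key {U V} (hU : SmoothFieldAt U x) (hV : SmoothFieldAt V x) :
      mvfderiv 𝓘(ℝ, E) (fun y => mvfderiv 𝓘(ℝ, E) (metric g Z W) y (V y)) x (U x) =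
        g.inner x (leviCivita g (fun y => leviCivita g Z y (V y)) x (U x)) (W x)
        + g.inner x (leviCivita g Z x (V x)) (leviCivita g W x (U x))
        + (g.inner x (leviCivita g Z x (U x)) (leviCivita g W x (V x))
        + g.inner x (Z x) (leviCivita g (fun y => leviCivita g W y (V y)) x (U x))) := by
    have e : (fun y => mvfderiv 𝓘(ℝ, E) (metric g Z W) y (V y)) =ᶠ[𝓝 x]
        metric g (fun y => leviCivita g Z y (V y)) W +
          metric g Z (fun y => leviCivita g W y (V y)) := by
      filter_upwards [hZ.eventually_mdifferentiableAt, hW.eventually_mdifferentiableAt] with y h1 h2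
      exact leviCivita_metric' g (V y) h1 h2
    have hz := mdifferentiableAt_leviCivita g hV hZ
    have hw := mdifferentiableAt_leviCivita g hV hW
    rw [mvfderiv_congr e,
      mvfderiv_add (mdifferentiableAt_metric g hz hW.mdifferentiableAt)
      (mdifferentiableAt_metric g hZ.mdifferentiableAt hw), add_apply,
      leviCivita_metric' g _ hz hW.mdifferentiableAt, leviCivita_metric' g _ hZ.mdifferentiableAt hw]
  -- The cross terms `g(∇_X Z, ∇_Y W) + g(∇_Y Z, ∇_X W)` are symmetric in `X`, `Y` and drop out of
  -- the commutator.
  rw [key hX hY, key hY hX, leviCivita_metric' g _ hZ.mdifferentiableAt hW.mdifferentiableAt] at hbr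
  simp only [curvature, map_sub, sub_apply]
  linarith

/-- The curvature `R(X, Y)Z` at `x` only depends on the value of `Z` at `x`. -/
lemma curvature_congr (hX : SmoothFieldAt X x) (hY : SmoothFieldAt Y x)
    (hZ : SmoothFieldAt Z x) (hW : SmoothFieldAt W x) (h : Z x = W x) :
    curvature g X Y Z x = curvature g X Y W x := by
  -- Skew-symmetry moves the derivatives from `Z` to the test field, leaving only the value of `Z`
  -- at `x`.
  apply inner_left_ext g
  intro v
  have hv := smoothFieldAt_extend v
  have h1 := inner_curvature_comm g hX hY hZ hv
  have h2 := inner_curvature_comm g hX hY hW hv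
  rw [FiberBundle.extend_apply_self] at h1 h2
  rw [h1, h2, h]

variable {g}

lemma leviCivita_add_apply (hX : MDiffAt (T% X) x) (hY : MDiffAt (T% Y) x)
    (v : TangentSpace 𝓘(ℝ, E) x) :
    leviCivita g (X + Y) x v = leviCivita g X x v + leviCivita g Y x v := by
  rw [(leviCivita g).isCovariantDerivativeOnUniv.add hX hY, add_apply]

lemma leviCivita_smul_apply {f : M → ℝ} (hf : MDiffAt f x) (hX : MDiffAt (T% X) x)
    (v : TangentSpace 𝓘(ℝ, E) x) :
    leviCivita g (f • X) x v = f x • leviCivita g X x v + mvfderiv 𝓘(ℝ, E) f x v • X x := by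
  rw [(leviCivita g).isCovariantDerivativeOnUniv.leibniz hX hf]
  simp

/-! ### Contractions with the inverse metric. -/

lemma sum_inv_gram_mul_inner (x : M) :
    ∑ i, ∑ j, (gram g x)⁻¹ i j * g.inner x (tangentBasis x i) (tangentBasis x j) =
      Module.finrank ℝ E := by
  have hu : IsUnit (gram g x).det := isUnit_det_gramMatrix g (tangentBasis x)
  have h : ((gram g x)⁻¹ * gram g x).trace = Module.finrank ℝ E := by
    rw [Matrix.nonsing_inv_mul _ hu, Matrix.trace_one, Fintype.card_fin]
  rw [← h, Matrix.trace]
  refine Finset.sum_congr rfl fun i _ => ?_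
  rw [Matrix.diag_apply, Matrix.mul_apply]
  refine Finset.sum_congr rfl fun j _ => ?_
  rw [gram, Matrix.of_apply, g.symm]

/-- With `v = ξ` this is the trace of `η ⊗ η`, needed for the scalar curvature. -/
lemma sum_inv_gram_mul_inner_mul_inner (v : TangentSpace 𝓘(ℝ, E) x) :
    ∑ i, ∑ j, (gram g x)⁻¹ i j * (g.inner x (tangentBasis x i) v * g.inner x (tangentBasis x j) v) =
      g.inner x v v := by
  have hu : IsUnit (gram g x).det := isUnit_det_gramMatrix g (tangentBasis x)
  have hg : (fun i => g.inner x (tangentBasis x i) v) =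
      Matrix.mulVec (gram g x) (fun i => (tangentBasis x).repr v i) := by
    funext i
    conv_lhs => rw [← (tangentBasis x).sum_repr v, map_sum]
    simp [Matrix.mulVec, dotProduct, gram, mul_comm]
  have h1 : Matrix.mulVec (gram g x)⁻¹ (fun i => g.inner x (tangentBasis x i) v) =
      fun i => (tangentBasis x).repr v i := by
    rw [hg, Matrix.mulVec_mulVec, Matrix.nonsing_inv_mul _ hu, Matrix.one_mulVec]
  have h2 : g.inner x v v =
      ∑ i, (tangentBasis x).repr v i * g.inner x (tangentBasis x i) v := by
    conv_lhs =>
      arg 1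
      rw [← (tangentBasis x).sum_repr v, map_sum]
    simp
  rw [h2]
  refine Finset.sum_congr rfl fun i _ => ?_
  rw [← congrFun h1 i, Matrix.mulVec, dotProduct, Finset.sum_mul]
  exact Finset.sum_congr rfl fun j _ => by ring

/-! ### Almost contact identities and the derivative of `ξ`. -/

namespace AlmostContactMetric

variable (A : AlmostContactMetric g) {α β : M → ℝ} {lam mu : ℝ}

lemma inner_xi_xi (x : M) : g.inner x (A.xi x) (A.xi x) = 1 := by
  rw [← A.eta_eq, A.eta_xi]

lemma phi_xi (x : M) : A.phi x (A.xi x) = 0 := by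
  by_contra h
  have h1 := g.pos x _ h
  rw [A.metric_phi_phi, A.inner_xi_xi, A.eta_xi] at h1
  norm_num at h1

lemma eta_phi (v : TangentSpace 𝓘(ℝ, E) x) : A.eta x (A.phi x v) = 0 := by
  have h := A.metric_phi x (A.xi x) v
  rw [A.phi_xi, map_zero, add_zero, g.symm] at h
  rw [A.eta_eq, h]

/-- Differentiate `g(ξ,ξ) = 1`. -/
lemma eta_leviCivita_xi (v : TangentSpace 𝓘(ℝ, E) x) :
    A.eta x (leviCivita g A.xi x v) = 0 := by
  have hξ := (A.smooth_xi x).mdifferentiableAt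
  have h := leviCivita_metric' g v hξ hξ
  have h1 : metric g A.xi A.xi = fun _ => 1 := funext A.inner_xi_xi
  rw [h1, mvfderiv_const, g.symm x (A.xi x), ← A.eta_eq] at h
  simp at h
  linarith

variable {A}

/-- `∇_v ξ = -α φ v + β (v - η(v) ξ)`. -/
lemma IsTransSasakian.leviCivita_xi (hA : A.IsTransSasakian α β) (v : TangentSpace 𝓘(ℝ, E) x) :
    leviCivita g A.xi x v = -(α x • A.phi x v) + β x • (v - A.eta x v • A.xi x) := by
  have h := hA.nablaPhi_eq x _ _ (smoothFieldAt_extend v) (A.smooth_xi x)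
  have h0 : (fun y => A.phi y (A.xi y)) = 0 := funext A.phi_xi
  rw [nablaPhi, h0, CovariantDerivative.zero, FiberBundle.extend_apply_self, A.eta_xi,
    ← A.eta_eq, ← A.eta_eq, A.eta_phi] at h
  -- Taking `Y = ξ` leaves `-φ(∇_v ξ)` on the left. Applying `φ` recovers `∇_v ξ`, because it has no
  -- `ξ`-component.
  have h2 := congrArg (A.phi x) h
  simp only [map_sub, map_add, map_smul, A.phi_phi, A.phi_xi, eta_leviCivita_xi, Pi.zero_apply,
    zero_apply, map_zero, zero_smul, one_smul, smul_zero] at h2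
  rw [zero_sub, add_zero, neg_neg] at h2
  rw [h2]
  module

lemma IsTransSasakian.inner_leviCivita_xi (hA : A.IsTransSasakian α β)
    (v w : TangentSpace 𝓘(ℝ, E) x) :
    g.inner x w (leviCivita g A.xi x v) =
      -(α x * g.inner x w (A.phi x v)) + β x * (g.inner x w v - A.eta x v * A.eta x w) := by
  rw [hA.leviCivita_xi]
  simp [A.eta_eq]

lemma IsTransSasakian.lieDerivMetric_xi (hA : A.IsTransSasakian α β) (hX : SmoothFieldAt X x)
    (hY : SmoothFieldAt Y x) :
    lieDerivMetric g A.xi X Y x =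
      2 * β x * (g.inner x (X x) (Y x) - A.eta x (X x) * A.eta x (Y x)) := by
  have hξ := (A.smooth_xi x).mdifferentiableAt
  rw [lieDerivMetric, leviCivita_metric' g _ hX.mdifferentiableAt hY.mdifferentiableAt,
    ← leviCivita_torsionFree g hξ hX.mdifferentiableAt,
    ← leviCivita_torsionFree g hξ hY.mdifferentiableAt]
  have h1 := hA.inner_leviCivita_xi (X x) (Y x)
  have h2 := hA.inner_leviCivita_xi (Y x) (X x)
  have h3 := A.metric_phi x (X x) (Y x)
  have h4 := g.symm x (Y x) (X x)
  have h5 := g.symm x (leviCivita g A.xi x (X x)) (Y x)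
  simp only [map_sub, sub_apply]
  rw [h5, h1, h2, h4]
  -- The `α` terms cancel because `φ` is skew for `g`.
  linear_combination (-α x) * h3

/-! ### The Ricci tensor of the soliton and its derivative. -/

/-- The Ricci tensor of an `η`-Einstein soliton on a trans-Sasakian 3-manifold. -/
lemma IsTransSasakian.ricci_eq (hA : A.IsTransSasakian α β)
    (hdim : Module.finrank ℝ E = 3) (hsol : A.IsEtaEinsteinSoliton lam mu)
    (v w : TangentSpace 𝓘(ℝ, E) x) :
    ricci g x v w =
      (2 * lam + β x + mu) * g.inner x v w + (β x - mu) * (A.eta x v * A.eta x w) := by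
  have h (v w : TangentSpace 𝓘(ℝ, E) x) : ricci g x v w =
      (scalarCurvature g x / 2 - lam - β x) * g.inner x v w
        + (β x - mu) * (A.eta x v * A.eta x w) := by
    have hv := smoothFieldAt_extend v
    have hw := smoothFieldAt_extend w
    have h1 := hsol x _ _ hv hw
    rw [hA.lieDerivMetric_xi hv hw, FiberBundle.extend_apply_self,
      FiberBundle.extend_apply_self] at h1
    linear_combination h1 / 2
  -- Tracing the formula, which still contains `r`, determines `r = 6λ + 4β + 2μ`.
  have hr : scalarCurvature g x = (scalarCurvature g x / 2 - lam - β x) * 3 + (β x - mu) := by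
    have h1 := sum_inv_gram_mul_inner (g := g) x
    have h2 := sum_inv_gram_mul_inner_mul_inner (g := g) (A.xi x)
    rw [A.inner_xi_xi] at h2
    rw [show (Module.finrank ℝ E : ℝ) = 3 by rw [hdim]; norm_num] at h1
    conv_lhs => rw [scalarCurvature]
    simp only [h, A.eta_eq, mul_add, Finset.sum_add_distrib, mul_left_comm _ (_ - _ : ℝ),
      ← Finset.mul_sum]
    rw [h1, h2]
    ring
  rw [h]
  linear_combination (-g.inner x v w) * hr

/-- The covariant derivative of the Ricci tensor. -/
lemma IsTransSasakian.nablaRicci_eq (hA : A.IsTransSasakian α β)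
    (hdim : Module.finrank ℝ E = 3) (hsol : A.IsEtaEinsteinSoliton lam mu)
    (hY : SmoothFieldAt Y x) (hZ : SmoothFieldAt Z x) :
    nablaRicci g X Y Z x =
      mvfderiv 𝓘(ℝ, E) β x (X x) * (g.inner x (Y x) (Z x) + A.eta x (Y x) * A.eta x (Z x))
        + (β x - mu) * (g.inner x (Y x) (leviCivita g A.xi x (X x)) * A.eta x (Z x)
          + A.eta x (Y x) * g.inner x (Z x) (leviCivita g A.xi x (X x))) := by
  have hβ : MDiffAt β x := hA.smooth_beta.mdifferentiableAt (by simp)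
  have hξ := (A.smooth_xi x).mdifferentiableAt
  have hYd := hY.mdifferentiableAt
  have hZd := hZ.mdifferentiableAt
  have hYZ := mdifferentiableAt_metric g hYd hZd
  have hYξ := mdifferentiableAt_metric g hYd hξ
  have hZξ := mdifferentiableAt_metric g hZd hξ
  -- Writing `η` as `g(·, ξ)` reduces the derivative of `η ⊗ η` to metric compatibility.
  have hf : (fun y => ricci g y (Y y) (Z y)) =
      ((fun _ => 2 * lam + mu) + β) * metric g Y Z
        + ((fun _ => -mu) + β) * (metric g Y A.xi * metric g Z A.xi) := by
    funext y
    simp only [hA.ricci_eq hdim hsol, Pi.add_apply, Pi.mul_apply, metric, A.eta_eq]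
    ring
  have hc (c : ℝ) : MDiffAt (fun _ : M => c) x := mdifferentiableAt_const
  rw [nablaRicci, hf, mvfderiv_add (((hc _).add hβ).mul hYZ) (((hc _).add hβ).mul (hYξ.mul hZξ)),
    mvfderiv_mul ((hc _).add hβ) hYZ, mvfderiv_mul ((hc _).add hβ) (hYξ.mul hZξ),
    mvfderiv_mul hYξ hZξ, mvfderiv_add (hc _) hβ, mvfderiv_add (hc _) hβ, mvfderiv_const,
    mvfderiv_const]
  simp only [hA.ricci_eq hdim hsol, add_apply, smul_apply, zero_apply, leviCivita_metric' g _ hYd hZd,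
    leviCivita_metric' g _ hYd hξ, leviCivita_metric' g _ hZd hξ, Pi.add_apply, Pi.mul_apply,
    metric, A.eta_eq, smul_eq_mul]
  ring

/-! ### Curvature in the direction of `ξ`. -/

/-- Where `α` vanishes, `∇_v ξ = β (v - η(v) ξ)` can be differentiated once more. -/
lemma IsTransSasakian.leviCivita_leviCivita_xi (hA : A.IsTransSasakian α β)
    (hα : ∀ᶠ y in 𝓝 x, α y = 0) (hX : SmoothFieldAt X x) (v : TangentSpace 𝓘(ℝ, E) x) :
    leviCivita g (fun y => leviCivita g A.xi y (X y)) x v =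
      β x • (leviCivita g X x v - A.eta x (X x) • leviCivita g A.xi x v
        - (g.inner x (leviCivita g X x v) (A.xi x)
          + g.inner x (X x) (leviCivita g A.xi x v)) • A.xi x)
      + mvfderiv 𝓘(ℝ, E) β x v • (X x - A.eta x (X x) • A.xi x) := by
  have hβ : MDiffAt β x := hA.smooth_beta.mdifferentiableAt (by simp)
  have hξ := (A.smooth_xi x).mdifferentiableAt
  have hXd := hX.mdifferentiableAt
  have hη : MDiffAt ((fun _ : M => (-1 : ℝ)) * metric g X A.xi) x :=
    mdifferentiableAt_const.mul (mdifferentiableAt_metric g hXd hξ)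
  have hηξ := hη.smul_section hξ
  have hs := mdifferentiableAt_add_section hXd hηξ
  have e : ∀ᶠ y in 𝓝 x, leviCivita g A.xi y (X y) =
      (β • (X + ((fun _ => -1) * metric g X A.xi) • A.xi)) y := by
    filter_upwards [hα] with y hy
    rw [hA.leviCivita_xi, hy]
    simp [metric, A.eta_eq, sub_eq_add_neg]
  -- A second derivative sees the germ, so `α = 0` is needed on a neighbourhood and not just at `x`.
  rw [(leviCivita g).isCovariantDerivativeOnUniv.congr_of_eventuallyEq
    (mdifferentiableAt_leviCivita g hX (A.smooth_xi x)) (hβ.smul_section hs) Filter.univ_mem e,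
    leviCivita_smul_apply hβ hs, leviCivita_add_apply hXd hηξ, leviCivita_smul_apply hη hξ,
    mvfderiv_mul mdifferentiableAt_const (mdifferentiableAt_metric g hXd hξ), mvfderiv_const]
  simp only [smul_apply, leviCivita_metric' g _ hXd hξ, Pi.add_apply, Pi.mul_apply,
    Pi.smul_apply', metric, A.eta_eq, smul_eq_mul, smul_zero, add_zero]
  module

/-- `R(X, ξ)ξ = -(ξ β + β²) (X - η(X) ξ)` where `α` vanishes. -/
lemma IsTransSasakian.curvature_xi (hA : A.IsTransSasakian α β)
    (hα : ∀ᶠ y in 𝓝 x, α y = 0) (hX : SmoothFieldAt X x) (hY : SmoothFieldAt Y x)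
    (hYx : Y x = A.xi x) :
    curvature g X Y A.xi x =
      -(mvfderiv 𝓘(ℝ, E) β x (A.xi x) + β x ^ 2) • (X x - A.eta x (X x) • A.xi x) := by
  have hX0 (v : TangentSpace 𝓘(ℝ, E) x) : leviCivita g A.xi x v = β x • (v - A.eta x v • A.xi x) := by
    rw [hA.leviCivita_xi, hα.self_of_nhds]
    simp
  -- `Y` equals `ξ` only at `x`. The terms in `∇Y` and `∇X` cancel against the bracket by
  -- torsion-freeness.
  rw [curvature, hA.leviCivita_leviCivita_xi hα hX, hA.leviCivita_leviCivita_xi hα hY, hX0,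
    ← leviCivita_torsionFree g hX.mdifferentiableAt hY.mdifferentiableAt, hYx, hX0, hX0]
  simp only [A.eta_xi, map_sub, map_smul, ← A.eta_eq, sub_apply, smul_apply,
    g.symm x (A.xi x), smul_eq_mul]
  module

/-- `S(ξ, ξ) = -2 (ξ β + β²)` where `α` vanishes. -/
lemma IsTransSasakian.ricci_xi_xi (hA : A.IsTransSasakian α β)
    (hα : ∀ᶠ y in 𝓝 x, α y = 0) (hdim : Module.finrank ℝ E = 3) :
    ricci g x (A.xi x) (A.xi x) = -2 * (mvfderiv 𝓘(ℝ, E) β x (A.xi x) + β x ^ 2) := by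
  have hξ := smoothFieldAt_extend (A.xi x)
  have hb (i) := smoothFieldAt_extend (tangentBasis (E := E) x i)
  have h (i) : curvature g (FiberBundle.extend E (tangentBasis x i))
      (FiberBundle.extend E (A.xi x)) (FiberBundle.extend E (A.xi x)) x =
      -(mvfderiv 𝓘(ℝ, E) β x (A.xi x) + β x ^ 2) •
        (tangentBasis x i - A.eta x (tangentBasis x i) • A.xi x) := by
    -- `ricci` uses an arbitrary extension of `ξ x`; in the third slot it may be replaced by the
    -- field `ξ`.
    rw [curvature_congr g (hb i) hξ hξ (A.smooth_xi x) (FiberBundle.extend_apply_self E _),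
      hA.curvature_xi hα (hb i) hξ (FiberBundle.extend_apply_self E _),
      FiberBundle.extend_apply_self]
  -- The trace of `η ⊗ ξ` is 1, so `I - η ⊗ ξ` has trace `3 - 1 = 2`.
  have hη : ∑ i, A.eta x (tangentBasis x i) * (tangentBasis x).repr (A.xi x) i = 1 := by
    rw [← A.eta_xi x]
    conv_rhs => rw [← (tangentBasis x).sum_repr (A.xi x), map_sum]
    simp [mul_comm]
  simp only [ricci, h, map_smul, map_sub, Module.Basis.coord_apply, smul_eq_mul, mul_sub,
    Finset.sum_sub_distrib, Module.Basis.repr_self, Finsupp.single_eq_same, ← Finset.mul_sum, hη]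
  simp [hdim]
  ring

/-! ### Consequences of the Codazzi equation. -/

/-- Each `w - η(w)ξ` lies in `ker η`; if that kernel were zero, `ξ` would span the tangent space. -/
lemma exists_eta_eq_zero (A : AlmostContactMetric g) (x : M) (hdim : 1 < Module.finrank ℝ E) :
    ∃ v : TangentSpace 𝓘(ℝ, E) x, v ≠ 0 ∧ A.eta x v = 0 := by
  by_contra! h
  have : Module.finrank ℝ (TangentSpace 𝓘(ℝ, E) x) ≤ 1 := by
    refine finrank_le_one (A.xi x) fun w => ⟨A.eta x w, ?_⟩
    by_contra hne
    refine h (w - A.eta x w • A.xi x) (fun h0 => hne (sub_eq_zero.1 h0).symm) ?_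
    simp [A.eta_xi]
  exact absurd this (not_le.2 hdim)

/-- On a trans-Sasakian 3-manifold with an `η`-Einstein soliton and Codazzi Ricci tensor,
`α = 0` and `ξ β = β (β - μ)` wherever `β ≠ μ`. -/
lemma IsTransSasakian.alpha_eq_zero_and_mvfderiv_beta (hA : A.IsTransSasakian α β)
    (hdim : Module.finrank ℝ E = 3) (hsol : A.IsEtaEinsteinSoliton lam mu)
    (hcod : HasCodazziRicci g) (hx : β x ≠ mu) :
    α x = 0 ∧ mvfderiv 𝓘(ℝ, E) β x (A.xi x) = β x * (β x - mu) := by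
  obtain ⟨v, hv0, hv⟩ := A.exists_eta_eq_zero x (by omega)
  have hvs := smoothFieldAt_extend v
  have hps := smoothFieldAt_extend (A.phi x v)
  have hξ := A.smooth_xi x
  have hpos : 0 < g.inner x v v := g.pos x v hv0
  have hsub : β x - mu ≠ 0 := sub_ne_zero.2 hx
  have hskew : g.inner x v (A.phi x v) = 0 := by linarith [A.metric_phi x v v]
  have hskew' : g.inner x (A.phi x v) v = 0 := by rw [g.symm, hskew]
  have hpp : g.inner x (A.phi x v) (A.phi x v) = g.inner x v v := by
    rw [A.metric_phi_phi, hv]; ring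
  have hvpp : g.inner x v (A.phi x (A.phi x v)) = - g.inner x v v := by
    rw [A.phi_phi, hv]; simp
  have hξv : g.inner x (A.xi x) v = 0 := by rw [g.symm, ← A.eta_eq, hv]
  -- The triple `(v, φv, ξ)` isolates `α`: the two sides are `∓α(β-μ)|v|²`.
  have h1 := hcod.2 x _ _ _ hvs hps hξ
  -- The triple `(v, ξ, v)` isolates `ξβ`: the two sides are `β(β-μ)|v|²` and `(ξβ)|v|²`.
  have h2 := hcod.2 x _ _ _ hvs hξ hvs
  simp only [hA.nablaRicci_eq hdim hsol, hvs, hps, hξ, hA.inner_leviCivita_xi,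
    FiberBundle.extend_apply_self, A.eta_phi, A.phi_xi, hv, A.eta_xi, hskew, hskew', hpp, hvpp, hξv,
    ← A.eta_eq, map_zero] at h1 h2
  have hα : α x = 0 := by
    have h : α x * ((β x - mu) * g.inner x v v) = 0 := by
      linear_combination (-1 / 2) * h1
    exact (mul_eq_zero.1 h).resolve_right (mul_ne_zero hsub hpos.ne')
  refine ⟨hα, ?_⟩
  refine mul_right_cancel₀ hpos.ne' ?_
  linear_combination -h2

/-- On a trans-Sasakian 3-manifold with an `η`-Einstein soliton and Codazzi Ricci tensor,
`β` and `λ` vanish wherever `β ≠ μ`. -/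
lemma IsTransSasakian.beta_eq_zero_and_lam_eq_zero (hA : A.IsTransSasakian α β)
    (hdim : Module.finrank ℝ E = 3) (hsol : A.IsEtaEinsteinSoliton lam mu)
    (hcod : HasCodazziRicci g) (hx : β x ≠ mu) : β x = 0 ∧ lam = 0 := by
  have hβc : Continuous β := hA.smooth_beta.continuous
  have hev : ∀ᶠ y in 𝓝 x, β y ≠ mu := hβc.continuousAt.eventually_ne hx
  -- Two values of `S(ξ,ξ)`: `2λ + 2β` from the soliton, and `-2(β(β-μ) + β²)` from the curvature.
  have hlam (y) (hy : ∀ᶠ z in 𝓝 y, β z ≠ mu) : lam = -2 * β y ^ 2 + (mu - 1) * β y := by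
    have h1 := hA.ricci_xi_xi
      (hy.mono fun z hz => (hA.alpha_eq_zero_and_mvfderiv_beta hdim hsol hcod hz).1) hdim
    rw [hA.ricci_eq hdim hsol,
      (hA.alpha_eq_zero_and_mvfderiv_beta hdim hsol hcod hy.self_of_nhds).2, A.inner_xi_xi,
      A.eta_xi] at h1
    linear_combination h1 / 2
  have hβ (y) : MDiffAt β y := hA.smooth_beta.mdifferentiableAt (by simp)
  have hquad (y) (hy : ∀ᶠ z in 𝓝 y, β z ≠ mu) :
      (-4 * β y + (mu - 1)) * mvfderiv 𝓘(ℝ, E) β y (A.xi y) = 0 := by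
    have e : (fun _ : M => lam) =ᶠ[𝓝 y]
        (fun _ => -2) * (β * β) + (fun _ => mu - 1) * β := by
      filter_upwards [hy.eventually_nhds] with z hz
      simp only [Pi.add_apply, Pi.mul_apply]
      linear_combination hlam z hz
    have hc (c : ℝ) : MDiffAt (fun _ : M => c) y := mdifferentiableAt_const
    have h := congrArg (fun l => l (A.xi y)) (mvfderiv_congr e)
    simp only [mvfderiv_add ((hc _).mul ((hβ y).mul (hβ y))) ((hc _).mul (hβ y)),
      mvfderiv_mul (hc _) ((hβ y).mul (hβ y)), mvfderiv_mul (hc _) (hβ y),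
      mvfderiv_mul (hβ y) (hβ y), mvfderiv_const] at h
    simp at h
    linear_combination -h
  have hβ0 : β x = 0 := by
    by_contra hne
    -- Near `x`, `ξβ = β(β-μ)` is nonzero, so the other factor in `hquad` vanishes and pins `β` to a
    -- constant.
    have e : β =ᶠ[𝓝 x] fun _ => (mu - 1) / 4 := by
      filter_upwards [hev.eventually_nhds, hβc.continuousAt.eventually_ne hne] with y hy hy0
      have h := hquad y hy
      have hy' := hy.self_of_nhds
      rw [(hA.alpha_eq_zero_and_mvfderiv_beta hdim hsol hcod hy').2] at h
      have := (mul_eq_zero.1 h).resolve_right (mul_ne_zero hy0 (sub_ne_zero.2 hy'))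
      linarith
    have h := (hA.alpha_eq_zero_and_mvfderiv_beta hdim hsol hcod hx).2
    rw [mvfderiv_congr e, mvfderiv_const] at h
    exact mul_ne_zero hne (sub_ne_zero.2 hx) h.symm
  refine ⟨hβ0, ?_⟩
  rw [hlam x hev, hβ0]
  ring

end AlmostContactMetric

end TransSasakian

/-! ### The theorem. -/

theorem theorem4p1 {M : Type*} [TopologicalSpace M] [T2Space M] [SecondCountableTopology M]
    [ChartedSpace (EuclideanSpace ℝ (Fin 3)) M] [IsManifold (𝓡 3) ∞ M]
    (g : ContMDiffRiemannianMetric (𝓡 3) ∞ (EuclideanSpace ℝ (Fin 3))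
      (fun x : M => TangentSpace (𝓡 3) x))
    (A : TransSasakian.AlmostContactMetric g) (α β : M → ℝ) (hA : A.IsTransSasakian α β)
    (lam mu : ℝ) (hsol : A.IsEtaEinsteinSoliton lam mu)
    (hcod : TransSasakian.HasCodazziRicci g) :
    (∀ x : M, mu ≠ β x → α x = 0 ∧ lam = -(β x * (β x + 1))) ∧
    (((∀ x : M, mu ≠ β x) ∨ (ConnectedSpace M ∧ ∃ x : M, mu ≠ β x)) →
      A.IsBetaKenmotsu β ∧
      ∀ x : M, lam = -(β x * (β x + 1)) ∧
        (β x < -1 ∨ 0 < β x → lam < 0) ∧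
        (β x = -1 ∨ β x = 0 → lam = 0) ∧
        (-1 < β x ∧ β x < 0 → 0 < lam)) := by
  have hdim : Module.finrank ℝ (EuclideanSpace ℝ (Fin 3)) = 3 := by simp
  have hβ (x) (hx : mu ≠ β x) : β x = 0 ∧ lam = 0 :=
    hA.beta_eq_zero_and_lam_eq_zero hdim hsol hcod hx.symm
  have hα (x) (hx : mu ≠ β x) : α x = 0 :=
    (hA.alpha_eq_zero_and_mvfderiv_beta hdim hsol hcod hx.symm).1
  have hmain (x) (hx : mu ≠ β x) : α x = 0 ∧ lam = -(β x * (β x + 1)) := by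
    refine ⟨hα x hx, ?_⟩
    rw [(hβ x hx).1, (hβ x hx).2]
    norm_num
  refine ⟨hmain, fun h => ?_⟩
  have hall : ∀ x, mu ≠ β x := by
    rcases h with h | ⟨hM, x₀, hx₀⟩
    · exact h
    have hβc : Continuous β := hA.smooth_beta.continuous
    -- Since `β x₀ = 0 ≠ μ`, the open set `{β ≠ μ}` is exactly the closed set `{β = 0}`;
    -- connectedness makes it all of `M`.
    have hmu : mu ≠ 0 := by rwa [(hβ x₀ hx₀).1] at hx₀
    have hset : {x | mu ≠ β x} = {x | β x = 0} := by
      ext x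
      refine ⟨fun hx => (hβ x hx).1, fun hx => ?_⟩
      rw [Set.mem_ofPred_eq] at hx
      rwa [Set.mem_ofPred_eq, hx]
    have hclopen : IsClopen {x | mu ≠ β x} :=
      ⟨hset ▸ isClosed_eq hβc continuous_const, isOpen_ne_fun continuous_const hβc⟩
    exact fun x => (hclopen.eq_univ ⟨x₀, hx₀⟩).ge (Set.mem_univ x)
  -- As `β = 0` and `λ = 0` everywhere, the steady case is immediate and the shrinking and expanding
  -- cases are vacuous.
  refine ⟨?_, fun x => ⟨(hmain x (hall x)).2, ?_, fun _ => (hβ x (hall x)).2, ?_⟩⟩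
  · rwa [funext fun x => hα x (hall x)] at hA
  · rw [(hβ x (hall x)).1]
    intro h
    norm_num at h
  · rw [(hβ x (hall x)).1]
    intro h
    norm_num at h
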